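/- Let $K/k$ be a function field, i.e. $K$ is a finitely generated field extension of $k$ of transcendence degree $1$ and $k$ is relatively algebraically closed in $K$. Suppose that $k$ has positive characteristic $p$ and that $K$ is separably generated over $k$, i.e. $K$ is finite separable over $k(t)$ for some $t\in K$. Let $\Omega_{K/k}$ be the set of places of $K/k$, i.e. of discrete valuation rings of $K$ containing $k$; for $v\in\Omega_{K/k}$ let $K_v$ be the completion of $K$ at $v$. Let $m\ge 0$ and $M\ge 1$ be integers, let $kK^{p^m}$ be the compositum of $k$ and $K^{p^m}=\{x^{p^m}:x\in K\}$ in $K$, and let $(kK^{p^m})^*_v$ be the topological closure of $(kK^{p^m})^*$ in $K_v^*$. Let $\mathbf b=(b_1,\dots,b_M)\in(K^*)^M$. For a subset $\Theta$ of an extension ring of $K$, let $W_{\mathbf b}(\Theta)$ (resp. $W'_{\mathbf b}(\Theta)$) be the set of $(x_1,\dots,x_M)\in\Theta^M$ with $\sum_i b_ix_i=0$ (resp. $\sum_i b_ix_i=1$). Let $\psi_j(\mathbf b)$ be obtained from $\mathbf b$ by replacing its $j$-th component by $1$. (a) Suppose that the components of $\mathbf b$ are linearly independent over $kK^{p^m}$.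 Then $W_{\mathbf b}\left((kK^{p^m})^*_v\right)=\emptyset$ for all $v\in\Omega_{K/k}$. (b) Suppose that for some $j$ the components of $\psi_j(\mathbf b)$ are linearly independent over $kK^{p^m}$. Then there is some $P\in W'_{\mathbf b}(K)$ such that $$\prod_{v\in\Omega_{K/k}}W'_{\mathbf b}\left((kK^{p^m})^*_v\right)\subset\{P\},$$ where $P$ is identified with its diagonal image in $\prod_{v\in\Omega_{K/k}}K_v^M$. If, moreover, the components of $\mathbf b$ or those of some $\psi_l(\mathbf b)$ are linearly dependent over $kK^{p^m}$, then $W'_{\mathbf b}\left((kK^{p^m})^*_v\right)=\emptyset$ for all $v\in\Omega_{K/k}$. -/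

import Mathlib

open scoped IntermediateField

/-- `K / k` is a function field: `K` is finitely generated over `k` as a field, of transcendence
degree one, and `k` is relatively algebraically closed in `K`. -/
structure IsFunctionFieldOver (k K : Type*) [Field k] [Field K] [Algebra k K] : Prop where
  fg : (⊤ : IntermediateField k K).FG
  trdeg_eq_one : Algebra.trdeg k K = 1
  mem_range_of_isAlgebraic : ∀ x : K, IsAlgebraic k x → x ∈ Set.range (algebraMap k K)

/-- `K` is separably generated over `k`: it is finite separable over `k(t)` for some `t ∈ K`. -/
def IsSeparablyGeneratedOver (k K : Type*) [Field k] [Field K] [Algebra k K] : Prop :=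
  ∃ t : K, FiniteDimensional k⟮t⟯ K ∧ Algebra.IsSeparable k⟮t⟯ K

/-- A place of `K / k`: a discrete valuation ring of `K` that contains the constant field `k`. -/
structure FunctionFieldPlace (k K : Type*) [Field k] [Field K] [Algebra k K] where
  ring : ValuationSubring K
  algebraMap_mem : ∀ a : k, algebraMap k K a ∈ ring
  isDVR : IsDiscreteValuationRing ring

namespace FunctionFieldPlace

variable {k K : Type*} [Field k] [Field K] [Algebra k K]

/-- The completion `K_v` of `K` at the place `v`, with its `v`-adic topology. -/
abbrev Completion (v : FunctionFieldPlace k K) : Type _ := v.ring.valuation.Completion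

/-- The canonical embedding `K → K_v`. -/
noncomputable def embed (v : FunctionFieldPlace k K) : K →+* v.Completion :=
  (UniformSpace.Completion.coeRingHom (α := WithVal v.ring.valuation)).comp
    (WithVal.equiv v.ring.valuation).symm.toRingHom

end FunctionFieldPlace

/-- The compositum `k K^{q}` in `K`, i.e. the subfield generated over `k` by all `q`-th powers;
it is used for `q = p ^ m`, with `p` the characteristic. -/
def powCompositum (k K : Type*) [Field k] [Field K] [Algebra k K] (q : ℕ) :
    IntermediateField k K :=
  IntermediateField.adjoin k (Set.range fun x : K => x ^ q)

/-- The closure in `K_v^*` (with its topology as unit group of `K_v`) of the image of the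
multiplicative group `F^*` of a subfield `F` of `K`. -/
def unitsClosureAt {k K : Type*} [Field k] [Field K] [Algebra k K] (F : IntermediateField k K)
    (v : FunctionFieldPlace k K) : Set (v.Completion)ˣ :=
  closure (Units.map (v.embed : K →* v.Completion) '' {u : Kˣ | (u : K) ∈ F})

/-- The solutions of `b · X = e` in an extension ring `L` of `K` (via `φ : K → L`) with all
coordinates in the subset `Θ` of `L`. -/
def linearSolutions {K L : Type*} [Field K] [CommRing L] (φ : K →+* L) {M : ℕ} (b : Fin M → Kˣ)
    (e : L) (Θ : Set L) : Set (Fin M → L) :=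
  {x | (∀ i, x i ∈ Θ) ∧ ∑ i, φ (b i : K) * x i = e}

/-- The map `ψ_j` replaces the `j`-th component by `1` and keeps the others. -/
def replaceByOne {K : Type*} [Field K] {M : ℕ} (j : Fin M) (b : Fin M → Kˣ) : Fin M → Kˣ :=
  Function.update b j 1

/-- The components of `b` are linearly independent over the subfield `F`. -/
def IndependentOver {k K : Type*} [Field k] [Field K] [Algebra k K] (F : IntermediateField k K)
    {M : ℕ} (b : Fin M → Kˣ) : Prop :=
  LinearIndependent F (fun i => (b i : K))

open IntermediateField Filter Topology
open scoped IntermediateField.algebraAdjoinAdjoin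

/-! Write `F` for $kK^{p^m}$ and $q=p^m$. The heart is that independence over `F` persists over the
closure of `F` in $K_v$ (`eq_zero_of_sum_embed_mul_eq_zero`). If $\sum a_ix_i=0$ and $f_i\in F$ tend
to $x_i$, a functional $l:K\to F$ dual to $a_j$ gives $f_j=l(\sum a_if_i)\to 0$, provided $l$ is
$v$-continuous. Continuity holds because the valuation ring $O$ lies in a finitely generated module
over $O\cap F$; this is where separability enters, through finiteness of the integral closure of
$k[t]$. Part (a) is then immediate. For (b), a local solution makes $1,b_1,\dots,b_M$ dependent over
`F`. Independence of some $\psi_j(b)$ makes such a relation unique up to scaling, even over the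
closure, so one relation over `F` determines the solutions at all places. -/

/-! ### Finiteness of a valuation ring over its intersection with `F` -/

/-- The fractional ideal $I=(1,z)$ is invertible, so $1=u+zw$ with $u,w\in I^{-1}$. Then $u,w,uz,wz$
all lie in $A$, and $u$ or $w$ has valuation $1$, as otherwise $v(1)<1$. -/
theorem exists_mul_mem_of_isDedekindDomain {A K : Type*} [CommRing A] [IsDedekindDomain A]
    [Field K] [Algebra A K] [IsFractionRing A K] (O : ValuationSubring K)
    (hA : ∀ a : A, algebraMap A K a ∈ O) {z : K} (hz : z ∈ O) :
    ∃ s a : A, O.valuation (algebraMap A K s) = 1 ∧ algebraMap A K s * z = algebraMap A K a := by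
  let I : FractionalIdeal (nonZeroDivisors A) K :=
    FractionalIdeal.spanSingleton _ 1 + FractionalIdeal.spanSingleton _ z
  have h1I : (1 : K) ∈ I := (FractionalIdeal.mem_add _ _ _).2
    ⟨1, FractionalIdeal.mem_spanSingleton_self _ _, 0, FractionalIdeal.zero_mem _, add_zero _⟩
  have hzI : z ∈ I := (FractionalIdeal.mem_add _ _ _).2
    ⟨0, FractionalIdeal.zero_mem _, z, FractionalIdeal.mem_spanSingleton_self _ _, zero_add _⟩
  have hI : I ≠ 0 := by
    intro h
    rw [h, FractionalIdeal.mem_zero_iff] at h1I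
    exact one_ne_zero h1I
  have hone : (1 : K) ∈ I * I⁻¹ := by
    rw [mul_inv_cancel₀ hI]
    exact FractionalIdeal.one_mem_one _
  rw [add_mul, FractionalIdeal.mem_add] at hone
  obtain ⟨x, hx, y, hy, hxy⟩ := hone
  obtain ⟨u, hu, rfl⟩ := FractionalIdeal.mem_singleton_mul.1 hx
  obtain ⟨w, hw, rfl⟩ := FractionalIdeal.mem_singleton_mul.1 hy
  have key : ∀ r ∈ I⁻¹, ∀ i ∈ I, ∃ a : A, algebraMap A K a = r * i := fun r hr i hi =>
    (FractionalIdeal.mem_one_iff _).1 ((FractionalIdeal.mem_inv_iff hI).1 hr i hi)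
  obtain ⟨u0, hu0⟩ := key u hu 1 h1I
  obtain ⟨u1, hu1⟩ := key u hu z hzI
  obtain ⟨w0, hw0⟩ := key w hw 1 h1I
  obtain ⟨w1, hw1⟩ := key w hw z hzI
  rw [mul_one] at hu0 hw0
  have le (a : A) : O.valuation (algebraMap A K a) ≤ 1 := (O.valuation_le_one_iff _).2 (hA a)
  by_cases hu' : O.valuation (algebraMap A K u0) = 1
  · exact ⟨u0, u1, hu', by rw [hu0, hu1]⟩
  by_cases hw' : O.valuation (algebraMap A K w0) = 1
  · exact ⟨w0, w1, hw', by rw [hw0, hw1]⟩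
  exfalso
  have h1 : O.valuation u < 1 := hu0 ▸ lt_of_le_of_ne (le u0) hu'
  have h2 : O.valuation (z * w) < 1 := by
    rw [map_mul]
    exact (mul_le_of_le_one_left' ((O.valuation_le_one_iff _).2 hz)).trans_lt
      (hw0 ▸ lt_of_le_of_ne (le w0) hw')
  have h3 := O.valuation.map_add_lt h1 h2
  rw [one_mul] at hxy
  rw [hxy, map_one] at h3
  exact lt_irrefl _ h3

/-- The intersection of an intermediate field and a valuation ring. -/
def IntermediateField.interValuationSubring {k K : Type*} [Field k] [Field K] [Algebra k K]
    (F : IntermediateField k K) (O : ValuationSubring K) : Subring K :=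
  F.toSubring ⊓ O.toSubring

/-- A valuation ring over `k` that contains a separating element `t` is finitely generated as a
module over its intersection with any intermediate field containing all `q`-th powers. -/
theorem exists_finite_le_span_of_mem {k K : Type*} [Field k] [Field K] [Algebra k K]
    (F : IntermediateField k K) {q : ℕ} (hq : q ≠ 0) (hF : ∀ x : K, x ^ q ∈ F)
    (O : ValuationSubring K) (hO : ∀ a : k, algebraMap k K a ∈ O)
    (t : K) (ht : t ∈ O) [FiniteDimensional k⟮t⟯ K] [Algebra.IsSeparable k⟮t⟯ K] :
    ∃ S : Set K, S.Finite ∧ ∀ z ∈ O, z ∈ Submodule.span (F.interValuationSubring O) S := by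
  let W := F.interValuationSubring O
  let R := Algebra.adjoin k {t}
  have hRsurj : Function.Surjective
      ((Polynomial.aeval t : Polynomial k →ₐ[k] K).rangeRestrict) :=
    AlgHom.rangeRestrict_surjective _
  have hR : R = (Polynomial.aeval t : Polynomial k →ₐ[k] K).range :=
    Algebra.adjoin_singleton_eq_range_aeval k t
  have : IsPrincipalIdealRing R := by
    rw [hR]
    exact IsPrincipalIdealRing.of_surjective _ hRsurj
  have : IsScalarTower R k⟮t⟯ K := inferInstance
  let A := integralClosure R K
  have : IsDedekindDomain A := integralClosure.isDedekindDomain R k⟮t⟯ K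
  have : IsFractionRing A K := IsIntegralClosure.isFractionRing_of_finite_extension R k⟮t⟯ K A
  have : Module.Finite R A := IsIntegralClosure.finite R k⟮t⟯ K A
  have hRO : ∀ r ∈ R, r ∈ O := by
    intro r hr
    induction hr using Algebra.adjoin_induction with
    | mem x hx => rw [Set.mem_singleton_iff.1 hx]; exact ht
    | algebraMap r => exact hO r
    | add x y _ _ hx hy => exact O.add_mem _ _ hx hy
    | mul x y _ _ hx hy => exact O.mul_mem _ _ hx hy
  have hAO : ∀ a : A, algebraMap A K a ∈ O := by
    intro a
    have ha : IsIntegral R (a : K) := a.2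
    let : Algebra R O := ((algebraMap R K).codRestrict O.toSubring fun r => hRO _ r.2).toAlgebra
    have : IsScalarTower R O K := IsScalarTower.of_algebraMap_eq fun _ => rfl
    have h2 : IsIntegral O (a : K) := IsIntegral.tower_top ha
    obtain ⟨y, hy⟩ := IsIntegrallyClosed.isIntegral_iff.1 h2
    change (a : K) ∈ O
    rw [← hy]
    exact y.2
  obtain ⟨s, hs⟩ := Module.Finite.fg_top (R := R) (M := A)
  -- Since $t^q\in F\cap O$, the powers $t^j$ with $j<q$ suffice to pass from $k[t]$ to `W`.
  let S : Set K := ⋃ j ∈ Finset.range q, (fun g : A => t ^ j * (g : K)) '' (s : Set A)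
  have hSmem : ∀ j < q, ∀ g ∈ s, t ^ j * (g : K) ∈ S := fun j hj g hg =>
    Set.mem_biUnion (Finset.mem_coe.2 (Finset.mem_range.2 hj)) ⟨g, hg, rfl⟩
  have hWsmul : ∀ c ∈ F, c ∈ O → ∀ x ∈ Submodule.span W S, c * x ∈ Submodule.span W S :=
    fun c h1 h2 x hx => Submodule.smul_mem _ (⟨c, h1, h2⟩ : W) hx
  have hkF (a : k) : algebraMap k K a ∈ F := F.algebraMap_mem a
  have htsmul : ∀ x ∈ Submodule.span W S, t * x ∈ Submodule.span W S := by
    intro x hx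
    induction hx using Submodule.span_induction with
    | zero => rw [mul_zero]; exact Submodule.zero_mem _
    | add x y _ _ hx hy => rw [mul_add]; exact Submodule.add_mem _ hx hy
    | smul c x _ hx =>
      have : t * (c • x) = c • (t * x) := by
        change t * ((c : K) * x) = (c : K) * (t * x)
        ring
      rw [this]
      exact Submodule.smul_mem _ _ hx
    | mem x hx =>
      simp only [S, Set.mem_iUnion, Finset.mem_range] at hx
      obtain ⟨j, hj, g, hg, rfl⟩ := hx
      rcases Nat.lt_or_ge (j + 1) q with h | h
      · have := Submodule.subset_span (R := W) (hSmem (j + 1) h g hg)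
        rwa [pow_succ', mul_assoc] at this
      · have hjq : j + 1 = q := by omega
        have := hWsmul _ (hF t) (pow_mem ht q) _
          (Submodule.subset_span (R := W) (hSmem 0 (by omega) g hg))
        rwa [pow_zero, one_mul, ← hjq, pow_succ', mul_assoc] at this
  have hRsmul : ∀ r ∈ R, ∀ x ∈ Submodule.span W S, r * x ∈ Submodule.span W S := by
    intro r hr
    induction hr using Algebra.adjoin_induction with
    | mem x hx => rw [Set.mem_singleton_iff.1 hx]; exact htsmul
    | algebraMap r => exact hWsmul _ (hkF r) (hO r)
    | add x y _ _ hx hy =>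
      intro z hz
      rw [add_mul]
      exact Submodule.add_mem _ (hx z hz) (hy z hz)
    | mul x y _ _ hx hy =>
      intro z hz
      rw [mul_assoc]
      exact hx _ (hy z hz)
  have hAspan : ∀ a : A, (a : K) ∈ Submodule.span W S := by
    intro a
    have ha : a ∈ Submodule.span R (s : Set A) := hs ▸ Submodule.mem_top
    induction ha using Submodule.span_induction with
    | zero => exact Submodule.zero_mem _
    | add x y _ _ hx hy => exact Submodule.add_mem _ hx hy
    | smul c x _ hx => exact hRsmul _ c.2 _ hx
    | mem x hx =>
      have := Submodule.subset_span (R := W) (hSmem 0 (by omega) x hx)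
      rwa [pow_zero, one_mul] at this
  refine ⟨S, Set.Finite.biUnion (Finset.finite_toSet _) fun j _ => s.finite_toSet.image _, ?_⟩
  intro z hz
  obtain ⟨d, a, hd, hda⟩ := exists_mul_mem_of_isDedekindDomain O hAO hz
  have hd0 : algebraMap A K d ≠ 0 := by
    intro h
    rw [h, map_zero] at hd
    exact zero_ne_one hd
  -- The denominator $d$ need not lie in `F`, but $d^q$ does, and it is still a unit of $O$.
  have hz' : z = ((algebraMap A K d) ^ q)⁻¹ * ((a * d ^ (q - 1) : A) : K) := by
    obtain ⟨n, rfl⟩ := Nat.exists_eq_succ_of_ne_zero hq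
    rw [eq_inv_mul_iff_mul_eq₀ (pow_ne_zero _ hd0)]
    change _ = algebraMap A K (a * d ^ n)
    rw [map_mul, map_pow, ← hda, Nat.succ_eq_add_one]
    ring
  rw [hz']
  refine hWsmul _ (F.inv_mem (hF _)) ?_ _ (hAspan _)
  rw [← O.valuation_le_one_iff, map_inv₀, map_pow, hd, one_pow, inv_one]

theorem exists_finite_le_span {k K : Type*} [Field k] [Field K] [Algebra k K]
    (hsep : IsSeparablyGeneratedOver k K)
    (F : IntermediateField k K) {q : ℕ} (hq : q ≠ 0) (hF : ∀ x : K, x ^ q ∈ F)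
    (O : ValuationSubring K) (hO : ∀ a : k, algebraMap k K a ∈ O) :
    ∃ S : Set K, S.Finite ∧ ∀ z ∈ O, z ∈ Submodule.span (F.interValuationSubring O) S := by
  obtain ⟨t, h1, h2⟩ := hsep
  rcases O.mem_or_inv_mem t with ht | ht
  · exact exists_finite_le_span_of_mem F hq hF O hO t ht
  · have heq : k⟮t⁻¹⟯ = k⟮t⟯ := by
      apply le_antisymm
      · rw [adjoin_simple_le_iff]
        exact inv_mem (mem_adjoin_simple_self k t)
      · rw [adjoin_simple_le_iff]
        simpa using inv_mem (mem_adjoin_simple_self k t⁻¹)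
    rw [← heq] at h1 h2
    exact exists_finite_le_span_of_mem F hq hF O hO t⁻¹ ht

theorem exists_ne_zero_forall_mul_mem {k K : Type*} [Field k] [Field K] [Algebra k K]
    (F : IntermediateField k K) (O : ValuationSubring K) {S : Set K} (hS : S.Finite)
    (l : K → F) : ∃ c : F, c ≠ 0 ∧ ∀ x ∈ S, ((c * l x : F) : K) ∈ O := by
  -- Requiring $c\in O$ as well lets the induction multiply denominators.
  suffices h : ∃ c : F, c ≠ 0 ∧ (c : K) ∈ O ∧ ∀ x ∈ S, ((c * l x : F) : K) ∈ O by
    obtain ⟨c, h1, -, h2⟩ := h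
    exact ⟨c, h1, h2⟩
  induction S, hS using Set.Finite.induction_on with
  | empty => exact ⟨1, one_ne_zero, O.one_mem, by simp⟩
  | @insert a S _ _ ih =>
    obtain ⟨c, hc, hcO, h⟩ := ih
    obtain ⟨d, hd, hdO, hda⟩ : ∃ d : F, d ≠ 0 ∧ (d : K) ∈ O ∧ ((d * l a : F) : K) ∈ O := by
      by_cases hla : (l a : K) ∈ O
      · exact ⟨1, one_ne_zero, O.one_mem, by simpa using hla⟩
      · have h0 : l a ≠ 0 := fun h0 => hla (by rw [h0]; exact O.zero_mem)
        refine ⟨(l a)⁻¹, inv_ne_zero h0, ?_, ?_⟩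
        · exact (O.mem_or_inv_mem _).resolve_left hla
        · rw [inv_mul_cancel₀ h0]
          exact O.one_mem
    refine ⟨c * d, mul_ne_zero hc hd, O.mul_mem _ _ hcO hdO, ?_⟩
    rintro x (rfl | hx)
    · rw [mul_assoc]
      exact O.mul_mem _ _ hcO hda
    · rw [mul_comm c d, mul_assoc]
      exact O.mul_mem _ _ hdO (h x hx)

/-- A linear functional to an intermediate field `F` containing all `q`-th powers maps some
nonzero multiple of the valuation ring into the valuation ring. -/
theorem exists_forall_mul_apply_mem {k K : Type*} [Field k] [Field K] [Algebra k K]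
    (hsep : IsSeparablyGeneratedOver k K)
    (F : IntermediateField k K) {q : ℕ} (hq : q ≠ 0) (hF : ∀ x : K, x ^ q ∈ F)
    (O : ValuationSubring K) (hO : ∀ a : k, algebraMap k K a ∈ O) (l : K →ₗ[F] F) :
    ∃ c : F, c ≠ 0 ∧ ∀ z ∈ O, ((c * l z : F) : K) ∈ O := by
  obtain ⟨S, hS, hspan⟩ := exists_finite_le_span hsep F hq hF O hO
  obtain ⟨c, hc, h⟩ := exists_ne_zero_forall_mul_mem F O hS l
  refine ⟨c, hc, fun z hz => ?_⟩
  have hz' := hspan z hz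
  clear hz
  induction hz' using Submodule.span_induction with
  | zero => simp [O.zero_mem]
  | add x y _ _ hx hy =>
    rw [map_add, mul_add]
    exact O.add_mem _ _ hx hy
  | smul w x _ hx =>
    have : w • x = (⟨w, w.2.1⟩ : F) • x := rfl
    rw [this, map_smul, smul_eq_mul, mul_left_comm]
    exact O.mul_mem _ _ w.2.2 hx
  | mem x hx => exact h x hx

/-! ### Continuity of functionals and independence over the closure -/

theorem ValuationSubring.tendsto_toVal_zero_iff {K α : Type*} [Field K] (O : ValuationSubring K)
    {f : α → K} {L : Filter α} :
    Tendsto (fun a => WithVal.toVal O.valuation (f a)) L (𝓝 0) ↔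
      ∀ y : K, y ≠ 0 → ∀ᶠ a in L, O.valuation (f a) < O.valuation y := by
  constructor
  · intro h y hy
    have hy0 : (Valued.v : Valuation (WithVal O.valuation) _).restrict
        (WithVal.toVal O.valuation y) ≠ 0 := by
      simpa using hy
    refine h.eventually (p := fun x => O.valuation x.ofVal < O.valuation y) ?_
    refine Valued.mem_nhds_zero.2 ⟨Units.mk0 _ hy0, fun x hx => ?_⟩
    exact (Valuation.restrict_lt_iff _).1 hx
  · intro h
    refine (Valued.hasBasis_nhds_zero _ _).tendsto_right_iff.2 fun γ _ => ?_
    obtain ⟨r, s, hr, hs, hγ⟩ := Valuation.exists_div_eq_of_unit _ γ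
    have hrs : (r / s).ofVal ≠ 0 := by
      refine (WithVal.ofVal_eq_zero _ _).not.2 ?_
      exact div_ne_zero ((Valuation.pos_iff _).1 hr) ((Valuation.pos_iff _).1 hs)
    filter_upwards [h _ hrs] with a ha
    rw [← hγ, ← map_div₀]
    exact (Valuation.restrict_lt_iff _).2 ha

theorem ValuationSubring.exists_valuation_lt_one {K : Type*} [Field K] (O : ValuationSubring K)
    [IsDiscreteValuationRing O] : ∃ x : K, x ≠ 0 ∧ O.valuation x < 1 := by
  obtain ⟨x, hx⟩ := IsDiscreteValuationRing.exists_irreducible O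
  refine ⟨x, fun h => hx.ne_zero (Subtype.ext h), ?_⟩
  exact (O.valuation_lt_one_iff x).1 ((IsLocalRing.mem_maximalIdeal _).2 hx.not_isUnit)

/-- Linear functionals to an intermediate field containing all `q`-th powers are continuous at
every place. -/
theorem tendsto_toVal_linearMap {k K α : Type*} [Field k] [Field K] [Algebra k K]
    (hsep : IsSeparablyGeneratedOver k K)
    (F : IntermediateField k K) {q : ℕ} (hq : q ≠ 0) (hF : ∀ x : K, x ^ q ∈ F)
    (v : FunctionFieldPlace k K) (l : K →ₗ[F] F) {f : α → K} {L : Filter α}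
    (hf : Tendsto (fun a => WithVal.toVal v.ring.valuation (f a)) L (𝓝 0)) :
    Tendsto (fun a => WithVal.toVal v.ring.valuation (l (f a) : K)) L (𝓝 0) := by
  have := v.isDVR
  rw [ValuationSubring.tendsto_toVal_zero_iff] at hf ⊢
  intro y hy
  obtain ⟨c, hc, hbound⟩ := exists_forall_mul_apply_mem hsep F hq hF v.ring v.algebraMap_mem l
  have hc' : (c : K) ≠ 0 := fun h => hc (Subtype.ext h)
  obtain ⟨x, hx0, hx⟩ := v.ring.exists_valuation_lt_one
  -- As $v(w)\le 1$, the power $w^q$, which lies in `F`, is at least as small as $w$; $l$ can then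
  -- be scaled by it.
  obtain ⟨w, hw0, hw1, hwy⟩ : ∃ w : K, w ≠ 0 ∧ v.ring.valuation w ≤ 1 ∧
      v.ring.valuation w < v.ring.valuation y := by
    rcases le_or_gt 1 (v.ring.valuation y) with h | h
    · exact ⟨x, hx0, hx.le, hx.trans_le h⟩
    · have : v.ring.valuation (x * y) < v.ring.valuation y := by
        rw [map_mul]
        exact mul_lt_of_lt_one_left (zero_lt_iff.2 ((Valuation.ne_zero_iff _).2 hy)) hx
      exact ⟨x * y, mul_ne_zero hx0 hy, (this.trans h).le, this⟩
  let e : F := ⟨w ^ q, hF w⟩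
  have he : (e : K) ≠ 0 := pow_ne_zero _ hw0
  have hey : v.ring.valuation (e : K) < v.ring.valuation y := by
    refine lt_of_le_of_lt ?_ hwy
    change v.ring.valuation (w ^ q) ≤ _
    rw [map_pow]
    exact pow_le_of_le_one zero_le hw1 hq
  filter_upwards [hf (e * c : K) (mul_ne_zero he hc')] with a ha
  have hu : (e * c : K)⁻¹ * f a ∈ v.ring := by
    rw [← ValuationSubring.valuation_le_one_iff, map_mul, map_inv₀]
    exact (inv_mul_lt_one₀ (zero_lt_iff.2 ((Valuation.ne_zero_iff _).2
      (mul_ne_zero he hc')))).2 ha |>.le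
  have hfa : f a = (e * c) • ((e * c : K)⁻¹ * f a) :=
    (mul_inv_cancel_left₀ (mul_ne_zero he hc') (f a)).symm
  have hl : (l (f a) : K) = e * ((c * l ((e * c : K)⁻¹ * f a) : F) : K) := by
    conv_lhs => rw [hfa, map_smul, smul_eq_mul, mul_assoc]
    rfl
  rw [hl, map_mul]
  exact (mul_le_of_le_one_right' ((ValuationSubring.valuation_le_one_iff _ _).2
    (hbound _ hu))).trans_lt hey

/-- Families in `K` that are linearly independent over an intermediate field `F` containing all
`q`-th powers remain independent over the closure of `F` in the completion at a place. -/
theorem eq_zero_of_sum_embed_mul_eq_zero {k K ι : Type*} [Field k] [Field K] [Algebra k K]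
    [Fintype ι] (hsep : IsSeparablyGeneratedOver k K)
    (F : IntermediateField k K) {q : ℕ} (hq : q ≠ 0) (hF : ∀ x : K, x ^ q ∈ F)
    (v : FunctionFieldPlace k K) {a : ι → K} (ha : LinearIndependent F a)
    {x : ι → v.Completion} (hx : ∀ i, x i ∈ closure (v.embed '' (F : Set K)))
    (hsum : ∑ i, v.embed (a i) * x i = 0) (j : ι) : x j = 0 := by
  classical
  let Φ : (ι → F) → ι → v.Completion := fun f i => v.embed (f i : K)
  have hxΦ : x ∈ closure (Set.range Φ) := by
    have : Set.range Φ = Set.univ.pi fun _ : ι => v.embed '' (F : Set K) := by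
      ext y
      constructor
      · rintro ⟨f, rfl⟩ i -
        exact ⟨f i, (f i).2, rfl⟩
      · intro h
        choose f hf hfy using fun i => h i (Set.mem_univ i)
        exact ⟨fun i => ⟨f i, hf i⟩, funext hfy⟩
    rw [this, closure_pi_set]
    exact fun i _ => hx i
  -- The filter of tuples from `F` that approach `x`.
  let L : Filter (ι → F) := comap Φ (𝓝 x)
  have : L.NeBot := comap_neBot_iff.2 fun s hs => by
    obtain ⟨_, hy, f, rfl⟩ := mem_closure_iff_nhds.1 hxΦ s hs
    exact ⟨f, hy⟩
  have hΦ (i : ι) : Tendsto (fun f : ι → F => v.embed (f i : K)) L (𝓝 (x i)) :=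
    tendsto_pi_nhds.1 (tendsto_comap : Tendsto Φ L (𝓝 x)) i
  have hind : IsInducing ((↑) : WithVal v.ring.valuation → v.Completion) :=
    UniformSpace.Completion.isUniformInducing_coe _ |>.isInducing
  have key {g : (ι → F) → K} : Tendsto (fun f => v.embed (g f)) L (𝓝 0) ↔
      Tendsto (fun f => WithVal.toVal v.ring.valuation (g f)) L (𝓝 0) := by
    rw [hind.tendsto_nhds_iff]
    rfl
  have hlim : Tendsto (fun f : ι → F => v.embed (∑ i, a i * (f i : K))) L (𝓝 0) := by
    rw [← hsum]
    simp only [map_sum, map_mul]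
    exact tendsto_finsetSum _ fun i _ => (hΦ i).const_mul _
  -- The `j`-th coordinate on the span of `a`, extended to all of $K$.
  obtain ⟨l, hl⟩ := LinearMap.exists_extend (p := Submodule.span F (Set.range a))
    ((Finsupp.lapply j).comp ha.repr : _ →ₗ[F] F)
  have hla (i : ι) : l (a i) = if i = j then 1 else 0 := by
    have h1 := LinearMap.congr_fun hl ⟨a i, Submodule.subset_span ⟨i, rfl⟩⟩
    have h2 := ha.repr_eq_single i ⟨a i, Submodule.subset_span ⟨i, rfl⟩⟩ rfl
    refine h1.trans ?_
    change ha.repr _ j = _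
    rw [h2, Finsupp.single_apply]
  have hlf (f : ι → F) : l (∑ i, a i * (f i : K)) = f j := by
    have (i : ι) : a i * (f i : K) = f i • a i := mul_comm _ _
    simp [this, hla]
  have h0 := key.2 (tendsto_toVal_linearMap hsep F hq hF v l (key.1 hlim))
  simp only [hlf] at h0
  exact tendsto_nhds_unique (hΦ j) h0

/-! ### Relations among $1,b_1,\dots,b_M$ and the equation $b\cdot X=1$ -/

/-- Slot `j` is free when $g_j=0$ and can carry the coefficient of $1$: relations among $1,b$
omitting $b_j$ are relations of $\psi_j(b)$. -/
theorem sum_replaceByOne_mul_update {K L : Type*} [Field K] [CommRing L] (φ : K →+* L) {M : ℕ}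
    (b : Fin M → Kˣ) (j : Fin M) (g₀ : L) {g : Fin M → L} (hg : g j = 0) :
    ∑ i, φ (replaceByOne j b i : K) * Function.update g j g₀ i =
      g₀ + ∑ i, φ (b i : K) * g i := by
  rw [← Finset.add_sum_erase _ _ (Finset.mem_univ j),
    ← Finset.add_sum_erase (f := fun i => φ (b i : K) * g i) _ (Finset.mem_univ j)]
  simp only [replaceByOne, Function.update_self, hg, Units.val_one, map_one, one_mul, mul_zero,
    zero_add]
  congr 1
  refine Finset.sum_congr rfl fun i hi => ?_
  rw [Function.update_of_ne (Finset.ne_of_mem_erase hi),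
    Function.update_of_ne (Finset.ne_of_mem_erase hi)]

section

variable {k K : Type*} [Field k] [Field K] [Algebra k K]

theorem not_independentOver_iff (F : IntermediateField k K) {M : ℕ} (b : Fin M → Kˣ) :
    ¬ IndependentOver F b ↔ ∃ e : Fin M → F, ∑ i, (b i : K) * (e i : K) = 0 ∧ ∃ i, e i ≠ 0 := by
  have h (e : Fin M → F) (i : Fin M) : (b i : K) * (e i : K) = e i • (b i : K) := mul_comm _ _
  rw [IndependentOver, Fintype.not_linearIndependent_iff]
  simp only [h]

/-- The topological closure of a subfield of `K` in the completion at a place. -/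
noncomputable def FunctionFieldPlace.closureSubring (F : IntermediateField k K) (v : FunctionFieldPlace k K) :
    Subring v.Completion :=
  (F.toSubring.map v.embed).topologicalClosure

theorem FunctionFieldPlace.embed_mem_closureSubring {F : IntermediateField k K}
    (v : FunctionFieldPlace k K) (d : F) : v.embed d ∈ v.closureSubring F :=
  subset_closure ⟨d, d.2, rfl⟩

theorem mem_closureSubring_of_mem_unitsClosureAt {F : IntermediateField k K}
    {v : FunctionFieldPlace k K} {x : v.Completion}
    (hx : x ∈ Units.val '' unitsClosureAt F v) : x ∈ v.closureSubring F ∧ x ≠ 0 := by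
  obtain ⟨u, hu, rfl⟩ := hx
  refine ⟨?_, u.ne_zero⟩
  refine map_mem_closure Units.continuous_val hu ?_
  rintro _ ⟨w, hw, rfl⟩
  exact ⟨w, hw, rfl⟩

variable (hsep : IsSeparablyGeneratedOver k K) (F : IntermediateField k K) {q : ℕ} (hq : q ≠ 0)
  (hF : ∀ x : K, x ^ q ∈ F) {M : ℕ} {b : Fin M → Kˣ}

include hsep hq hF

theorem exists_relation_of_mem_linearSolutions_one (v : FunctionFieldPlace k K)
    {x : Fin M → v.Completion}
    (hx : x ∈ linearSolutions v.embed b 1 (Units.val '' unitsClosureAt F v)) :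
    ∃ (d₀ : F) (d : Fin M → F), (d₀ : K) + ∑ i, (b i : K) * (d i : K) = 0 ∧
      (d₀ ≠ 0 ∨ ∃ i, d i ≠ 0) := by
  let a : Option (Fin M) → K := fun o => o.elim 1 fun i => b i
  have ha : ¬ LinearIndependent F a := by
    intro ha
    have := eq_zero_of_sum_embed_mul_eq_zero hsep F hq hF v ha
      (x := fun o => o.elim (-1) x) ?_ ?_ none
    · exact one_ne_zero (neg_eq_zero.1 this)
    · rintro (_ | i)
      · exact (v.closureSubring F).neg_mem (v.closureSubring F).one_mem
      · exact (mem_closureSubring_of_mem_unitsClosureAt (hx.1 i)).1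
    · rw [Fintype.sum_option]
      simp only [a, Option.elim_none, Option.elim_some, map_one, one_mul]
      rw [hx.2, neg_add_cancel]
  obtain ⟨g, hg, o, ho⟩ := Fintype.not_linearIndependent_iff.1 ha
  refine ⟨g none, fun i => g (some i), ?_, ?_⟩
  · rw [Fintype.sum_option] at hg
    have h (i : Fin M) : (b i : K) * (g (some i) : K) = g (some i) • (b i : K) := mul_comm _ _
    simp only [h]
    refine Eq.trans ?_ hg
    congr 1
    exact (mul_one _).symm
  · rcases o with _ | i
    · exact Or.inl ho
    · exact Or.inr ⟨i, ho⟩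

theorem eq_of_mem_linearSolutions_one {j : Fin M} (hj : IndependentOver F (replaceByOne j b))
    {d₀ : F} {d : Fin M → F} (hd : (d₀ : K) + ∑ i, (b i : K) * (d i : K) = 0)
    (hne : d₀ ≠ 0 ∨ ∃ i, d i ≠ 0) (v : FunctionFieldPlace k K) {x : Fin M → v.Completion}
    (hx : x ∈ linearSolutions v.embed b 1 (Units.val '' unitsClosureAt F v)) :
    d₀ ≠ 0 ∧ (∀ i, d i ≠ 0) ∧ ∀ i, x i = v.embed (-(d i : K) / d₀) := by
  let C := v.closureSubring F
  have hxC (i : Fin M) : x i ∈ C := (mem_closureSubring_of_mem_unitsClosureAt (hx.1 i)).1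
  have hx0 (i : Fin M) : x i ≠ 0 := (mem_closureSubring_of_mem_unitsClosureAt (hx.1 i)).2
  have hdC (c : F) : v.embed c ∈ C := v.embed_mem_closureSubring c
  have elim (g₀ : v.Completion) (g : Fin M → v.Completion) (h₀ : g₀ ∈ C) (h : ∀ i, g i ∈ C)
      (hgj : g j = 0) (hg : g₀ + ∑ i, v.embed (b i : K) * g i = 0) : g₀ = 0 ∧ ∀ i, g i = 0 := by
    have key := eq_zero_of_sum_embed_mul_eq_zero hsep F hq hF v hj
      (x := Function.update g j g₀) ?_ ((sum_replaceByOne_mul_update v.embed b j g₀ hgj).trans hg)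
    · refine ⟨by simpa using key j, fun i => ?_⟩
      by_cases hij : i = j
      · rw [hij, hgj]
      · simpa [hij] using key i
    · intro i
      by_cases hij : i = j
      · subst hij
        rw [Function.update_self]
        exact h₀
      · rw [Function.update_of_ne hij]
        exact h i
  have hdv : v.embed d₀ + ∑ i, v.embed (b i : K) * v.embed (d i) = 0 := by
    simpa using congrArg v.embed hd
  have hinj (c : F) : v.embed c = 0 ↔ c = 0 := by
    rw [map_eq_zero]
    exact ZeroMemClass.coe_eq_zero
  have hdj : d j ≠ 0 := by
    intro h
    obtain ⟨h1, h2⟩ := elim _ _ (hdC d₀) (fun i => hdC (d i)) ((hinj _).2 h) hdv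
    rcases hne with h0 | ⟨i, hi⟩
    · exact h0 ((hinj _).1 h1)
    · exact hi ((hinj _).1 (h2 i))
  -- The combination $d_j\cdot(-1,x)-x_j\cdot(d_0,d)$ of two relations has zero entry at `j`, hence
  -- vanishes.
  obtain ⟨h1, h2⟩ := elim (-v.embed (d j) - x j * v.embed d₀)
    (fun i => x i * v.embed (d j) - x j * v.embed (d i))
    (C.sub_mem (C.neg_mem (hdC _)) (C.mul_mem (hxC _) (hdC _)))
    (fun i => C.sub_mem (C.mul_mem (hxC _) (hdC _)) (C.mul_mem (hxC _) (hdC _)))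
    (sub_self _) (by
      have h : ∑ i, v.embed (b i : K) * (x i * v.embed (d j) - x j * v.embed (d i)) =
          (∑ i, v.embed (b i : K) * x i) * v.embed (d j) -
            x j * ∑ i, v.embed (b i : K) * v.embed (d i) := by
        rw [Finset.sum_mul, Finset.mul_sum, ← Finset.sum_sub_distrib]
        exact Finset.sum_congr rfl fun i _ => by ring
      rw [h, hx.2]
      linear_combination -x j * hdv)
  have hdj' : v.embed (d j) ≠ 0 := (hinj _).not.2 hdj
  have h0 : d₀ ≠ 0 := by
    rintro rfl
    simp [hdj] at h1
  refine ⟨h0, fun i hi => ?_, fun i => ?_⟩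
  · have := h2 i
    rw [hi, ZeroMemClass.coe_zero, map_zero, mul_zero, sub_zero] at this
    exact mul_ne_zero (hx0 i) hdj' this
  · rw [map_div₀, map_neg, eq_div_iff ((hinj _).not.2 h0)]
    refine mul_right_cancel₀ hdj' ?_
    linear_combination v.embed d₀ * h2 i - v.embed (d i) * h1

/-- A dependence of $b$ is a relation with $d_0=0$, one of $\psi_l(b)$ a relation with $d_l=0$; a
solution with nonzero coordinates excludes both. -/
theorem independentOver_of_mem_linearSolutions_one {j : Fin M}
    (hj : IndependentOver F (replaceByOne j b)) (v : FunctionFieldPlace k K)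
    {x : Fin M → v.Completion}
    (hx : x ∈ linearSolutions v.embed b 1 (Units.val '' unitsClosureAt F v)) :
    IndependentOver F b ∧ ∀ l, IndependentOver F (replaceByOne l b) := by
  constructor
  · by_contra h
    obtain ⟨e, he, hne⟩ := (not_independentOver_iff F b).1 h
    exact (eq_of_mem_linearSolutions_one hsep F hq hF hj (d₀ := 0)
      (by rw [ZeroMemClass.coe_zero, zero_add, he]) (Or.inr hne) v hx).1 rfl
  · intro l
    by_contra h
    obtain ⟨e, he, i, hi⟩ := (not_independentOver_iff F _).1 h
    have hsum := sum_replaceByOne_mul_update (RingHom.id K) b l (e l)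
      (g := fun i => (Function.update e l 0 i : F)) (by simp)
    have hup : Function.update (fun i => ((Function.update e l 0 i : F) : K)) l (e l) =
        fun i => (e i : K) := by
      funext n
      by_cases hn : n = l
      · subst hn
        simp
      · simp [hn]
    rw [hup] at hsum
    refine (eq_of_mem_linearSolutions_one hsep F hq hF hj (hsum.symm.trans he) ?_ v hx).2.1 l
      (Function.update_self ..)
    by_cases hil : i = l
    · exact Or.inl (hil ▸ hi)
    · exact Or.inr ⟨i, by rwa [Function.update_of_ne hil]⟩

end

/-! ### The main theorem -/

theorem pow_mem_powCompositum (k : Type*) {K : Type*} [Field k] [Field K] [Algebra k K] (q : ℕ)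
    (x : K) : x ^ q ∈ powCompositum k K q :=
  IntermediateField.subset_adjoin _ _ ⟨x, rfl⟩

theorem mainTheorem3 {k K : Type*} [Field k] [Field K] [Algebra k K]
    (p : ℕ) [Fact p.Prime] [CharP k p]
    (hK : IsFunctionFieldOver k K) (hsep : IsSeparablyGeneratedOver k K)
    (M : ℕ) (hM : 1 ≤ M) (b : Fin M → Kˣ) (m : ℕ) :
    (IndependentOver (powCompositum k K (p ^ m)) b →
      ∀ v : FunctionFieldPlace k K,
        linearSolutions v.embed b 0
          (Units.val '' unitsClosureAt (powCompositum k K (p ^ m)) v) = ∅) ∧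
    ((∃ j : Fin M, IndependentOver (powCompositum k K (p ^ m)) (replaceByOne j b)) →
      (∃ P ∈ linearSolutions (RingHom.id K) b 1 Set.univ,
        Set.univ.pi (fun v : FunctionFieldPlace k K =>
          linearSolutions v.embed b 1
            (Units.val '' unitsClosureAt (powCompositum k K (p ^ m)) v))
          ⊆ {fun (v : FunctionFieldPlace k K) (i : Fin M) => v.embed (P i)}) ∧
      ((¬ IndependentOver (powCompositum k K (p ^ m)) b ∨
          ∃ l : Fin M, ¬ IndependentOver (powCompositum k K (p ^ m)) (replaceByOne l b)) →
        ∀ v : FunctionFieldPlace k K,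
          linearSolutions v.embed b 1
            (Units.val '' unitsClosureAt (powCompositum k K (p ^ m)) v) = ∅)) := by
  have hq : p ^ m ≠ 0 := pow_ne_zero _ (Fact.out : p.Prime).ne_zero
  have hF := pow_mem_powCompositum k (K := K) (p ^ m)
  -- Only $k\subset F$ and $K^q\subset F$ matter from here on.
  generalize powCompositum k K (p ^ m) = F at hF ⊢
  refine ⟨fun hb v => ?_, fun ⟨j, hj⟩ => ⟨?_, fun h v => ?_⟩⟩
  · refine Set.eq_empty_iff_forall_notMem.2 fun x hx => ?_
    have hmem (i : Fin M) := mem_closureSubring_of_mem_unitsClosureAt (hx.1 i)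
    exact (hmem ⟨0, hM⟩).2
      (eq_zero_of_sum_embed_mul_eq_zero hsep F hq hF v hb (fun i => (hmem i).1) hx.2 _)
  · by_cases hne : ∃ v : FunctionFieldPlace k K,
        (linearSolutions v.embed b 1 (Units.val '' unitsClosureAt F v)).Nonempty
    · obtain ⟨v, x, hx⟩ := hne
      obtain ⟨d₀, d, hd, hdne⟩ := exists_relation_of_mem_linearSolutions_one hsep F hq hF v hx
      have h0 : (d₀ : K) ≠ 0 := fun h =>
        (eq_of_mem_linearSolutions_one hsep F hq hF hj hd hdne v hx).1 (Subtype.ext h)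
      refine ⟨fun i => -(d i : K) / d₀, ⟨fun _ => Set.mem_univ _, ?_⟩, fun y hy => ?_⟩
      · have (i : Fin M) : RingHom.id K (b i : K) * (-(d i : K) / d₀) =
            (b i : K) * (d i : K) * (-(d₀ : K)⁻¹) := by
          rw [RingHom.id_apply]
          ring
        simp only [this]
        rw [← Finset.sum_mul, eq_neg_of_add_eq_zero_right hd, neg_mul_neg, mul_inv_cancel₀ h0]
      · exact funext fun w => funext fun i =>
          (eq_of_mem_linearSolutions_one hsep F hq hF hj hd hdne w (hy w trivial)).2.2 i
    -- With no local solution at any place, any global solution serves as $P$.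
    · refine ⟨Pi.single j ((b j)⁻¹ : Kˣ), ⟨fun _ => Set.mem_univ _, ?_⟩, fun y hy => ?_⟩
      · simp [Pi.single_apply]
      · exact funext fun w => (hne ⟨w, y w, hy w trivial⟩).elim
  · refine Set.eq_empty_iff_forall_notMem.2 fun x hx => ?_
    obtain ⟨h1, h2⟩ := independentOver_of_mem_linearSolutions_one hsep F hq hF hj v hx
    rcases h with h | ⟨l, hl⟩
    · exact h h1
    · exact hl (h2 l)
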